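/- Let $\vec v\in\mathbb R^3$ be a unit vector and let $\lambda\in\mathbb R$. Let $\psi:\Sigma\to\mathbb R^3$ be a smooth immersion of a smooth surface $\Sigma$ without boundary, oriented by a Gauss map $N:\Sigma\to\mathbb S^2$ (a smooth unit normal vector field along $\psi$), and let $H$ be its mean curvature with respect to $N$, that is, the half trace of the shape operator $-dN$ (so that a round sphere of radius $r$ with its inward normal has $H=1/r$). The immersion is called a $\lambda$-translating soliton with density vector $\vec v$ if $$H(p)=\lambda+\frac{\langle N(p),\vec v\rangle}{2}\qquad\text{for all } p\in\Sigma .$$ **Theorem.** For every unit vector $\vec v$ and every $\lambda\in\mathbb R$, there is no closed $\lambda$-translating soliton with density vector $\vec v$: no smooth immersion into $\mathbb R^3$ of a non-empty compact surface without boundary (embedded or not, connected or not), oriented by a Gauss map, satisfies this equation. -/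

import Mathlib

open scoped Manifold ContDiff Matrix

noncomputable section

namespace LambdaSoliton

/-- The Euclidean plane, on which surfaces are modelled. -/
abbrev E2 : Type := EuclideanSpace ℝ (Fin 2)

/-- Euclidean space of dimension three, with its standard inner product. -/
abbrev E3 : Type := EuclideanSpace ℝ (Fin 3)

/-- The differential at `p` of a map `f` from a surface to Euclidean space.  The tangent space of
the surface at `p` is identified with the plane by the preferred chart at `p`. -/
def differential {S : Type*} [TopologicalSpace S] [ChartedSpace E2 S]
    (f : S → E3) (p : S) : E2 →L[ℝ] E3 :=
  mfderiv (𝓡 2) (𝓡 3) f p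

/-- The `i`-th coordinate vector of the tangent plane at a point. -/
def coordVec (i : Fin 2) : E2 := EuclideanSpace.single i 1

/-- `N` is a Gauss map of `ψ`: a smooth unit vector field along `ψ` that is everywhere orthogonal
to the tangent planes of `ψ`.  It fixes the orientation of the immersed surface. -/
structure IsGaussMap {S : Type*} [TopologicalSpace S] [ChartedSpace E2 S]
    (ψ N : S → E3) : Prop where
  smooth : ContMDiff (𝓡 2) (𝓡 3) ∞ N
  unit : ∀ p, ‖N p‖ = 1
  orthogonal : ∀ p (X : E2), inner ℝ (N p) (differential ψ p X) = 0

/-- The matrix `⟨dψ(eᵢ), dψ(eⱼ)⟩` of the first fundamental form (the induced metric) at `p`. -/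
def firstFundamentalForm {S : Type*} [TopologicalSpace S] [ChartedSpace E2 S]
    (ψ : S → E3) (p : S) : Matrix (Fin 2) (Fin 2) ℝ :=
  Matrix.of fun i j =>
    inner ℝ (differential ψ p (coordVec i)) (differential ψ p (coordVec j))

/-- The matrix `-⟨dN(eᵢ), dψ(eⱼ)⟩` of the second fundamental form with respect to `N` at `p`. -/
def secondFundamentalForm {S : Type*} [TopologicalSpace S] [ChartedSpace E2 S]
    (ψ N : S → E3) (p : S) : Matrix (Fin 2) (Fin 2) ℝ :=
  Matrix.of fun i j =>
    -inner ℝ (differential N p (coordVec i)) (differential ψ p (coordVec j))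

/-- The mean curvature `H` of `ψ` at `p` with respect to the Gauss map `N`: half the trace of the
second fundamental form relative to the first, that is, the average of the principal curvatures.
A round sphere of radius `r` has `H = 1 / r` for its inward normal. -/
def meanCurvature {S : Type*} [TopologicalSpace S] [ChartedSpace E2 S]
    (ψ N : S → E3) (p : S) : ℝ :=
  ((firstFundamentalForm ψ p)⁻¹ * secondFundamentalForm ψ N p).trace / 2

/-- The immersed surface `ψ`, oriented by its Gauss map `N`, is a `lam`-translating soliton with
density vector `v`: everywhere `H = lam + ⟨N, v⟩ / 2`. -/
structure IsTranslatingSoliton {S : Type*} [TopologicalSpace S] [ChartedSpace E2 S]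
    (v : E3) (lam : ℝ) (ψ N : S → E3) : Prop where
  immersion : Manifold.IsImmersion (𝓡 2) (𝓡 3) ∞ ψ
  gauss : IsGaussMap ψ N
  curvature_eq : ∀ p, meanCurvature ψ N p = lam + inner ℝ (N p) v / 2

end LambdaSoliton

end

/-!
The theorem follows from Stokes' theorem.  Let `A = (N + lam ψ) × v`, a vector field along `ψ`, and
consider the one-form `⟨A, dψ⟩` on the surface.  The second derivatives of `ψ` cancel in its
exterior derivative, which is therefore the antisymmetrization of `⟨dA, dψ⟩` (`wedge`).  As `N` is
a unit normal, `dN` maps into the tangent plane and has trace `-2 H`, and it follows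
(`wedge_cross`) that `d⟨A, dψ⟩ = (2 H - 2 lam) ⟨N, v⟩ σ`, where `σ = det(dψ, dψ, N)` is the area
form.  For a translating soliton this is `⟨N, v⟩ ^ 2 σ`.  An exact form has integral zero over a
closed surface, so `⟨N, v⟩ = 0` everywhere.  But at a maximum of the height `⟨ψ, v⟩` the vector `v`
is orthogonal to the tangent plane; being orthogonal to `N` as well, it is zero, a contradiction.

The form of Stokes' theorem needed here is `eq_zero_of_orientedWedge_nonneg`: if `d⟨A, dψ⟩` is a
nonnegative multiple of the area form everywhere, then it vanishes.  Its proof takes a finite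
partition of unity `ρ` subordinate to open sets `U i`, each in a chart on which the orientation
given by `N` has constant sign.  Each `d⟨ρ i A, dψ⟩` has integral zero in the chart `i`, by
integration by parts in the plane (`setIntegral_wedge_eq_zero`).  Splitting it by the functions
`ρ j`, moving the pieces to the charts `j` by the change of variables formula (`chartIntegral_eq`)
and summing over `i` gives `∑ j, ∫ ρ j d⟨A, dψ⟩ = 0`, where every term is nonnegative.
-/

noncomputable section

namespace LambdaSoliton

open MeasureTheory Set

/-! ### Linear algebra of a pair of tangent vectors and a normal -/

/-- The triple product `⟨a, b × c⟩`, that is, the determinant of the columns `a`, `b`, `c`. -/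
def tripleProduct (a b c : E3) : ℝ :=
  a 0 * (b 1 * c 2 - b 2 * c 1) - a 1 * (b 0 * c 2 - b 2 * c 0) + a 2 * (b 0 * c 1 - b 1 * c 0)

/-- The map `u ↦ u × v`. -/
def crossRight (v : E3) : E3 →L[ℝ] E3 :=
  LinearMap.toContinuousLinearMap
    { toFun := fun u => !₂[u 1 * v 2 - u 2 * v 1, u 2 * v 0 - u 0 * v 2, u 0 * v 1 - u 1 * v 0]
      map_add' := by
        intro a b; ext i; fin_cases i <;> simp <;> ring
      map_smul' := by
        intro a b; ext i; fin_cases i <;> simp <;> ring }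

lemma crossRight_apply (v u : E3) : crossRight v u =
    !₂[u 1 * v 2 - u 2 * v 1, u 2 * v 0 - u 0 * v 2, u 0 * v 1 - u 1 * v 0] := rfl

lemma inner_eq_sum_coords (a b : E3) : inner ℝ a b = a 0 * b 0 + a 1 * b 1 + a 2 * b 2 := by
  simp [PiLp.inner_apply, Fin.sum_univ_three]; ring

/-- The value on the coordinate vectors of the two-form `⟨F ∧ G⟩`, where `F` and `G`
are vector-valued one-forms on the plane.  For `F = dB` and `G = dψ` it is the exterior
derivative of `⟨B, dψ⟩`. -/
def wedge (F G : E2 →L[ℝ] E3) : ℝ :=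
  inner ℝ (F (coordVec 0)) (G (coordVec 1)) - inner ℝ (F (coordVec 1)) (G (coordVec 0))

/-- The value on the coordinate vectors of the two-form `det(F, F, n)`.  For `F = dψ` and `n` a
unit normal it is the area form with the orientation given by `n`. -/
def area (F : E2 →L[ℝ] E3) (n : E3) : ℝ := tripleProduct (F (coordVec 0)) (F (coordVec 1)) n

lemma map_eq_smul_add_smul {V : Type*} [AddCommGroup V] [Module ℝ V] [TopologicalSpace V]
    (F : E2 →L[ℝ] V) (X : E2) : F X = X 0 • F (coordVec 0) + X 1 • F (coordVec 1) := by
  rw [← map_smul, ← map_smul, ← map_add]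
  congr 1
  ext i; fin_cases i <;> simp [coordVec]

lemma det_eq_coords (T : E2 →L[ℝ] E2) :
    T.det = T (coordVec 0) 0 * T (coordVec 1) 1 - T (coordVec 1) 0 * T (coordVec 0) 1 := by
  have h := LinearMap.det_toMatrix (EuclideanSpace.basisFun (Fin 2) ℝ).toBasis (T : E2 →ₗ[ℝ] E2)
  rw [Matrix.det_fin_two] at h
  simp [LinearMap.toMatrix_apply] at h
  simpa [coordVec] using h.symm

lemma wedge_comp (F G : E2 →L[ℝ] E3) (T : E2 →L[ℝ] E2) :
    wedge (F.comp T) (G.comp T) = T.det * wedge F G := by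
  simp only [wedge, ContinuousLinearMap.comp_apply, det_eq_coords]
  rw [map_eq_smul_add_smul F (T (coordVec 0)), map_eq_smul_add_smul F (T (coordVec 1)),
    map_eq_smul_add_smul G (T (coordVec 0)), map_eq_smul_add_smul G (T (coordVec 1))]
  simp only [inner_add_left, inner_add_right, real_inner_smul_left, real_inner_smul_right]
  ring

lemma area_comp (F : E2 →L[ℝ] E3) (n : E3) (T : E2 →L[ℝ] E2) :
    area (F.comp T) n = T.det * area F n := by
  simp only [area, ContinuousLinearMap.comp_apply, det_eq_coords]
  rw [map_eq_smul_add_smul F (T (coordVec 0)), map_eq_smul_add_smul F (T (coordVec 1))]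
  simp only [tripleProduct, PiLp.add_apply, PiLp.smul_apply, smul_eq_mul]
  ring

/-- The square of the area form is the determinant of the first fundamental form. -/
lemma area_sq {F : E2 →L[ℝ] E3} {n : E3} (hn : ‖n‖ = 1) (h : ∀ X, inner ℝ n (F X) = 0) :
    area F n ^ 2 = inner ℝ (F (coordVec 0)) (F (coordVec 0)) *
      inner ℝ (F (coordVec 1)) (F (coordVec 1)) -
      inner ℝ (F (coordVec 0)) (F (coordVec 1)) ^ 2 := by
  have h1 : inner ℝ n n = 1 := by rw [real_inner_self_eq_norm_sq, hn]; norm_num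
  have ha := h (coordVec 0)
  have hb := h (coordVec 1)
  simp only [area, tripleProduct, inner_eq_sum_coords] at *
  generalize F (coordVec 0) = a at *
  generalize F (coordVec 1) = b at *
  -- The square of the determinant of `a, b, n` is their Gram determinant.
  have gram : tripleProduct a b n ^ 2 =
      inner ℝ a a * (inner ℝ b b * inner ℝ n n - inner ℝ n b ^ 2)
      - inner ℝ a b * (inner ℝ a b * inner ℝ n n - inner ℝ n a * inner ℝ n b)
      + inner ℝ n a * (inner ℝ a b * inner ℝ n b - inner ℝ b b * inner ℝ n a) := by
    simp only [tripleProduct, inner_eq_sum_coords]; ring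
  simp only [tripleProduct, inner_eq_sum_coords] at gram
  rw [gram, h1, ha, hb]; ring

lemma area_ne_zero {F : E2 →L[ℝ] E3} {n : E3} (hn : ‖n‖ = 1) (h : ∀ X, inner ℝ n (F X) = 0)
    (hF : Function.Injective F) : area F n ≠ 0 := by
  intro h0
  have h2 := area_sq hn h
  rw [h0] at h2
  set a := F (coordVec 0) with ha
  set b := F (coordVec 1) with hb
  have hne : b ≠ 0 := by
    intro hb0
    have : coordVec 1 = 0 := hF (by rw [← hb, hb0, map_zero])
    have := congrArg (fun X : E2 => X 1) this
    simp [coordVec] at this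
  -- Equality in the Cauchy-Schwarz inequality makes the columns dependent.
  have key : inner ℝ b b • a - inner ℝ a b • b = 0 := by
    rw [← inner_self_eq_zero (𝕜 := ℝ)]
    simp only [inner_sub_left, inner_sub_right, real_inner_smul_left, real_inner_smul_right,
      real_inner_comm a b]
    linear_combination (-inner ℝ b b) * h2
  have key2 : inner ℝ b b • coordVec 0 - inner ℝ a b • coordVec 1 = 0 :=
    hF (by rw [map_sub, map_smul, map_smul, map_zero, ← ha, ← hb, key])
  have := congrArg (fun X : E2 => X 0) key2
  simp [coordVec] at this
  exact hne this

lemma cross_eq_area_smul {F : E2 →L[ℝ] E3} {n : E3} (hn : ‖n‖ = 1)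
    (h : ∀ X, inner ℝ n (F X) = 0) :
    crossRight (F (coordVec 1)) (F (coordVec 0)) = area F n • n := by
  have h1 : inner ℝ n n = 1 := by rw [real_inner_self_eq_norm_sq, hn]; norm_num
  have ha := h (coordVec 0)
  have hb := h (coordVec 1)
  simp only [area, tripleProduct, inner_eq_sum_coords, crossRight_apply] at *
  generalize F (coordVec 0) = a at *
  generalize F (coordVec 1) = b at *
  ext i; fin_cases i
  · simp
    linear_combination (-(a 1 * b 2 - a 2 * b 1)) * h1 + (n 1 * b 2 - n 2 * b 1) * ha
      - (n 1 * a 2 - n 2 * a 1) * hb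
  · simp
    linear_combination (-(a 2 * b 0 - a 0 * b 2)) * h1 + (n 2 * b 0 - n 0 * b 2) * ha
      - (n 2 * a 0 - n 0 * a 2) * hb
  · simp
    linear_combination (-(a 0 * b 1 - a 1 * b 0)) * h1 + (n 0 * b 1 - n 1 * b 0) * ha
      - (n 0 * a 1 - n 1 * a 0) * hb

lemma exists_eq_smul_add_smul {F : E2 →L[ℝ] E3} {n : E3} (hn : ‖n‖ = 1)
    (h : ∀ X, inner ℝ n (F X) = 0)
    (hF : Function.Injective F) {u : E3} (hu : inner ℝ n u = 0) :
    ∃ s t : ℝ, u = s • F (coordVec 0) + t • F (coordVec 1) := by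
  have hw := area_ne_zero hn h hF
  have hc := cross_eq_area_smul hn h
  set w := area F n with hwdef
  -- The coefficients are those of Cramer's rule in the basis `F e₀, F e₁, n`.
  refine ⟨tripleProduct u (F (coordVec 1)) n / w, tripleProduct (F (coordVec 0)) u n / w, ?_⟩
  have key : w • u = tripleProduct u (F (coordVec 1)) n • F (coordVec 0)
      + tripleProduct (F (coordVec 0)) u n • F (coordVec 1) := by
    have h3 : w • u = tripleProduct u (F (coordVec 1)) n • F (coordVec 0)
      + tripleProduct (F (coordVec 0)) u n • F (coordVec 1)
      + inner ℝ (crossRight (F (coordVec 1)) (F (coordVec 0))) u • n := by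
      simp only [hwdef, area, tripleProduct, inner_eq_sum_coords, crossRight_apply]
      ext i; fin_cases i <;> simp <;> ring
    rw [h3, hc, real_inner_smul_left, hu]; simp
  rw [div_eq_inv_mul, div_eq_inv_mul, mul_smul, mul_smul, ← smul_add, ← key, smul_smul,
    inv_mul_cancel₀ hw, one_smul]

/-- The pointwise identity behind the theorem, for `F = dψ`, `M = dN` and the fundamental forms
`I`, `II`: the exterior derivative of `⟨(N + lam ψ) × v, dψ⟩` is `(2 H - 2 lam) ⟨N, v⟩` times the
area form. -/
lemma wedge_cross {F M : E2 →L[ℝ] E3} {n : E3} (hn : ‖n‖ = 1) (h : ∀ X, inner ℝ n (F X) = 0)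
    (hM : ∀ X, inner ℝ n (M X) = 0) (hF : Function.Injective F) (v : E3) (lam : ℝ)
    (I II : Matrix (Fin 2) (Fin 2) ℝ)
    (hI : I = Matrix.of fun i j => inner ℝ (F (coordVec i)) (F (coordVec j)))
    (hII : II = Matrix.of fun i j => -inner ℝ (M (coordVec i)) (F (coordVec j))) :
    wedge ((crossRight v).comp (M + lam • F)) F =
      ((I⁻¹ * II).trace - 2 * lam) * inner ℝ n v * area F n := by
  obtain ⟨s, t, hst⟩ := exists_eq_smul_add_smul hn h hF (hM (coordVec 0))
  obtain ⟨s', t', hst'⟩ := exists_eq_smul_add_smul hn h hF (hM (coordVec 1))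
  have hdet : IsUnit I.det := by
    rw [isUnit_iff_ne_zero, Matrix.det_fin_two, hI]
    have := pow_ne_zero 2 (area_ne_zero hn h hF)
    rw [area_sq hn h] at this
    simpa [real_inner_comm (F (coordVec 0)) (F (coordVec 1)), pow_two] using this
  -- The rows of `!![s, t; s', t']` are the coordinates of `M e₀`, `M e₁` in the basis `F e₀, F e₁`.
  have hII' : II = -(!![s, t; s', t'] * I) := by
    rw [hI, hII]
    ext i j
    simp only [Matrix.neg_apply, Matrix.mul_apply, Fin.sum_univ_two, Matrix.of_apply]
    revert i
    rw [Fin.forall_fin_two]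
    constructor <;> simp [hst, hst', inner_add_left, real_inner_smul_left]
  have htr : (I⁻¹ * II).trace = -(s + t') := by
    rw [hII', mul_neg, Matrix.trace_neg, Matrix.trace_mul_comm, Matrix.mul_assoc,
      Matrix.mul_nonsing_inv _ hdet, Matrix.mul_one, Matrix.trace_fin_two]
    simp
  have hc := cross_eq_area_smul hn h
  have hcv : inner ℝ (crossRight (F (coordVec 1)) (F (coordVec 0))) v = area F n * inner ℝ n v := by
    rw [hc, real_inner_smul_left]
  rw [htr]
  have : wedge ((crossRight v).comp (M + lam • F)) F = (-(s + t') - 2 * lam) *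
      inner ℝ (crossRight (F (coordVec 1)) (F (coordVec 0))) v := by
    simp only [wedge, ContinuousLinearMap.comp_apply, add_apply, smul_apply, hst, hst',
      inner_eq_sum_coords, crossRight_apply]
    simp
    ring
  rw [this, hcv]; ring

/-! ### Integration by parts in the plane -/

lemma integrableOn_of_eq_zero_off_compact {Ω K : Set E2} (hΩ : IsOpen Ω) (hK : IsCompact K)
    (hKΩ : K ⊆ Ω) {c : E2 → ℝ} (hc : ContinuousOn c Ω) (h0 : ∀ y ∈ Ω, y ∉ K → c y = 0) :
    IntegrableOn c Ω :=
  ((hc.mono hKΩ).integrableOn_compact hK).of_forall_sdiff_eq_zero hΩ.measurableSet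
    fun y hy => h0 y hy.1 hy.2

lemma setIntegral_fderiv_eq_zero {Ω K : Set E2} (hΩ : IsOpen Ω) (hK : IsCompact K)
    (hKΩ : K ⊆ Ω) {P : E2 → ℝ} (hP : ContDiffOn ℝ 1 P Ω) (h0 : ∀ y ∈ Ω, y ∉ K → P y = 0)
    (X : E2) :
    ∫ y in Ω, fderiv ℝ P y X = 0 := by
  -- The extension of `P` by zero is continuously differentiable on the whole plane.
  set Q := Ω.indicator P with hQ
  have hQK : ∀ y, y ∉ K → Q y = 0 := by
    intro y hy
    by_cases hyΩ : y ∈ Ω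
    · rw [hQ, indicator_of_mem hyΩ, h0 y hyΩ hy]
    · rw [hQ, indicator_of_notMem hyΩ]
  have hev : ∀ y ∈ Ω, Q =ᶠ[nhds y] P := fun y hy => by
    filter_upwards [hΩ.mem_nhds hy] with z hz using indicator_of_mem hz P
  have hev0 : ∀ y, y ∉ K → Q =ᶠ[nhds y] fun _ => (0 : ℝ) := fun y hy => by
    filter_upwards [hK.isClosed.isOpen_compl.mem_nhds hy] with z hz using hQK z hz
  have hQd : ContDiff ℝ 1 Q := by
    rw [contDiff_iff_contDiffAt]
    intro y
    by_cases hy : y ∈ Ω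
    · exact (hP.contDiffAt (hΩ.mem_nhds hy)).congr_of_eventuallyEq (hev y hy)
    · exact contDiffAt_const.congr_of_eventuallyEq (hev0 y fun h => hy (hKΩ h))
  have hcs : HasCompactSupport Q := HasCompactSupport.intro hK fun y hy => hQK y hy
  have hcont : Continuous fun y => fderiv ℝ Q y X :=
    (hQd.continuous_fderiv (by norm_num)).clm_apply continuous_const
  -- Integration by parts against the constant function `1`.
  have hint := integral_mul_fderiv_eq_neg_fderiv_mul_of_integrable (μ := (volume : Measure E2))
    (f := fun _ => (1 : ℝ)) (g := Q) (v := X) (by simp)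
    (by simpa using hcont.integrable_of_hasCompactSupport (hcs.fderiv_apply (𝕜 := ℝ) X))
    (by simpa using hQd.continuous.integrable_of_hasCompactSupport hcs)
    (fun _ _ => differentiableAt_const _)
    (fun y _ => hQd.differentiable (by norm_num) y)
  have hint' : ∫ y, fderiv ℝ Q y X = 0 := by simpa using hint
  rw [← hint', ← setIntegral_eq_integral_of_forall_compl_eq_zero (s := Ω)
    (f := fun y => fderiv ℝ Q y X)]
  · exact setIntegral_congr_fun hΩ.measurableSet fun y hy => by
      simp only [(hev y hy).fderiv_eq]
  · intro y hy
    rw [(hev0 y fun h => hy (hKΩ h)).fderiv_eq]; simp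

/-- The exterior derivative of the compactly supported one-form `⟨b, ds⟩` in a plane domain has
integral zero. -/
lemma setIntegral_wedge_eq_zero {Ω K : Set E2} (hΩ : IsOpen Ω) (hK : IsCompact K)
    (hKΩ : K ⊆ Ω) {b s : E2 → E3} (hb : ContDiffOn ℝ 1 b Ω) (hs : ContDiffOn ℝ 2 s Ω)
    (h0 : ∀ y ∈ Ω, y ∉ K → b y = 0) :
    ∫ y in Ω, wedge (fderiv ℝ b y) (fderiv ℝ s y) = 0 := by
  have hs' : ContDiffOn ℝ 1 (fderiv ℝ s) Ω := hs.fderiv_of_isOpen hΩ (by norm_num)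
  have hP : ∀ X : E2, ContDiffOn ℝ 1 (fun y => inner ℝ (b y) (fderiv ℝ s y X)) Ω :=
    fun X => hb.inner ℝ (hs'.clm_apply contDiffOn_const)
  have hP0 : ∀ X : E2, ∀ y ∈ Ω, y ∉ K → inner ℝ (b y) (fderiv ℝ s y X) = 0 := by
    intro X y hy hyK; rw [h0 y hy hyK, inner_zero_left]
  have hder : ∀ y ∈ Ω, ∀ X Y : E2, fderiv ℝ (fun y => inner ℝ (b y) (fderiv ℝ s y X)) y Y
      = inner ℝ (b y) (fderiv ℝ (fderiv ℝ s) y Y X)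
        + inner ℝ (fderiv ℝ b y Y) (fderiv ℝ s y X) := by
    intro y hy X Y
    have h1 : DifferentiableAt ℝ b y :=
      (hb.contDiffAt (hΩ.mem_nhds hy)).differentiableAt (by norm_num)
    have h2 : DifferentiableAt ℝ (fderiv ℝ s) y :=
      (hs'.contDiffAt (hΩ.mem_nhds hy)).differentiableAt (by norm_num)
    rw [fderiv_inner_apply ℝ h1 (h2.clm_apply (differentiableAt_const X)),
      fderiv_clm_apply h2 (differentiableAt_const X)]
    simp
  have hcont : ∀ X Y : E2, IntegrableOn
      (fun y => fderiv ℝ (fun y => inner ℝ (b y) (fderiv ℝ s y X)) y Y) Ω := by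
    intro X Y
    refine integrableOn_of_eq_zero_off_compact hΩ hK hKΩ
      (((hP X).continuousOn_fderiv_of_isOpen hΩ (by norm_num)).clm_apply continuousOn_const) ?_
    intro y hy hyK
    have : (fun y => inner ℝ (b y) (fderiv ℝ s y X)) =ᶠ[nhds y] fun _ => (0 : ℝ) := by
      filter_upwards [hΩ.mem_nhds hy, hK.isClosed.isOpen_compl.mem_nhds hyK] with z hz hzK
      exact hP0 X z hz hzK
    rw [this.fderiv_eq]; simp
  have : ∫ y in Ω, wedge (fderiv ℝ b y) (fderiv ℝ s y) =
      ∫ y in Ω, (fderiv ℝ (fun y => inner ℝ (b y) (fderiv ℝ s y (coordVec 1))) y (coordVec 0)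
        - fderiv ℝ (fun y => inner ℝ (b y) (fderiv ℝ s y (coordVec 0))) y (coordVec 1)) := by
    refine setIntegral_congr_fun hΩ.measurableSet fun y hy => ?_
    have hsym : fderiv ℝ (fderiv ℝ s) y (coordVec 0) (coordVec 1) =
        fderiv ℝ (fderiv ℝ s) y (coordVec 1) (coordVec 0) :=
      ((hs.contDiffAt (hΩ.mem_nhds hy)).isSymmSndFDerivAt (by simp)).eq _ _
    simp only [hder y hy, wedge, hsym]
    ring
  rw [this, integral_sub (hcont _ _) (hcont _ _),
    setIntegral_fderiv_eq_zero hΩ hK hKΩ (hP _) (hP0 _),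
    setIntegral_fderiv_eq_zero hΩ hK hKΩ (hP _) (hP0 _), sub_zero]

/-! ### Differentials and integrals in a chart -/

section Surface

variable {S : Type*} [TopologicalSpace S] [ChartedSpace E2 S]

/-- An immersion, defined by its normal form in charts, has injective differential. -/
lemma differential_injective [IsManifold (𝓡 2) ∞ S] {ψ : S → E3}
    (h : Manifold.IsImmersion (𝓡 2) (𝓡 3) ∞ ψ) (p : S) :
    Function.Injective (differential ψ p) := by
  have hp := h.isImmersionAt p
  -- A differentiable local left inverse, read off from the normal form of the immersion.
  let g : E3 → S := fun z => (hp.domChart.symm) ((hp.equiv.symm (hp.codChart z)).1)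
  have hmem := hp.mem_domChart_source
  have hnf : ∀ q ∈ hp.domChart.source, hp.codChart (ψ q) = hp.equiv (hp.domChart q, 0) := by
    intro q hq
    have hq' : hp.domChart q ∈ (hp.domChart.extend (𝓡 2)).target := by
      simpa using hp.domChart.map_source hq
    simpa [hp.domChart.left_inv hq] using hp.writtenInCharts hq'
  have hgψ : ∀ q ∈ hp.domChart.source, g (ψ q) = q := by
    intro q hq
    simp [g, hnf q hq, hp.domChart.left_inv hq]
  have hev : (g ∘ ψ) =ᶠ[nhds p] id := by
    filter_upwards [hp.domChart.open_source.mem_nhds hmem] with q hq using hgψ q hq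
  have hcod : MDifferentiableAt (𝓡 3) (𝓡 3) hp.codChart (ψ p) :=
    (contMDiffAt_of_mem_maximalAtlas hp.codChart_mem_maximalAtlas
      hp.mem_codChart_source).mdifferentiableAt (by simp)
  have hdom : MDifferentiableAt (𝓡 2) (𝓡 2) hp.domChart.symm
      ((hp.equiv.symm (hp.codChart (ψ p))).1) := by
    have : (hp.equiv.symm (hp.codChart (ψ p))).1 = hp.domChart p := by
      simp [hnf p hmem]
    rw [this]
    exact (contMDiffAt_symm_of_mem_maximalAtlas hp.domChart_mem_maximalAtlas
      (hp.domChart.map_source hmem)).mdifferentiableAt (by simp)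
  have hmid : MDifferentiableAt (𝓡 3) (𝓡 2)
      (fun z : E3 => (hp.equiv.symm z).1) (hp.codChart (ψ p)) := by
    apply DifferentiableAt.mdifferentiableAt
    fun_prop
  have hg : MDifferentiableAt (𝓡 3) (𝓡 2) g (ψ p) :=
    MDifferentiableAt.comp (f := fun z => (hp.equiv.symm (hp.codChart z)).1) (ψ p) hdom
      (MDifferentiableAt.comp (f := hp.codChart) (g := fun z : E3 => (hp.equiv.symm z).1)
        (ψ p) hmid hcod)
  have hψ : MDifferentiableAt (𝓡 2) (𝓡 3) ψ p := (h.contMDiff p).mdifferentiableAt (by simp)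
  have hcomp := mfderiv_comp p hg hψ
  rw [hev.mfderiv_eq, mfderiv_id] at hcomp
  intro X Y hXY
  have := fun Z : E2 => congrArg (fun L => L Z) hcomp
  have hX := this X
  have hY := this Y
  change X = (mfderiv (𝓡 3) (𝓡 2) g (ψ p)) (differential ψ p X) at hX
  change Y = (mfderiv (𝓡 3) (𝓡 2) g (ψ p)) (differential ψ p Y) at hY
  rw [hX, hY, hXY]

/-- The derivative at `y` of the inverse of the preferred chart at `x`, where the tangent plane of
the surface at the image of `y` is identified with the plane by the preferred chart at that
image. -/
def chartDeriv (x : S) (y : E2) : E2 →L[ℝ] E2 :=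
  mfderiv (𝓡 2) (𝓡 2) (chartAt E2 x).symm y

variable [IsManifold (𝓡 2) ∞ S]

lemma fderiv_comp_symm {B : S → E3} (hB : ContMDiff (𝓡 2) (𝓡 3) ∞ B) {x : S} {y : E2}
    (hy : y ∈ (chartAt E2 x).target) :
    fderiv ℝ (B ∘ (chartAt E2 x).symm) y =
      (differential B ((chartAt E2 x).symm y)).comp (chartDeriv x y) := by
  have : IsManifold (𝓡 2) 1 S := IsManifold.of_le (n := ∞) (by simp)
  rw [← mfderiv_eq_fderiv]
  exact mfderiv_comp y ((hB _).mdifferentiableAt (by simp))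
    (mdifferentiableAt_atlas_symm (chart_mem_atlas E2 x) hy)

lemma contDiffOn_comp_symm {B : S → E3} (hB : ContMDiff (𝓡 2) (𝓡 3) ∞ B) (x : S) :
    ContDiffOn ℝ ∞ (B ∘ (chartAt E2 x).symm) (chartAt E2 x).target := by
  rw [← contMDiffOn_iff_contDiffOn]
  exact hB.comp_contMDiffOn contMDiffOn_chart_symm

/-- The integral over `V`, computed in the preferred chart at `x`, of the density that at each point
`p` has the value `g p` in the preferred chart at `p`.  Only the part of `V` in the source of the
chart at `x` counts. -/
def chartIntegral (x : S) (V : Set S) (g : S → ℝ) : ℝ :=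
  ∫ y in (chartAt E2 x).target ∩ (chartAt E2 x).symm ⁻¹' V,
    g ((chartAt E2 x).symm y) * |(chartDeriv x y).det|

/-- The integral of a density over an open set in two charts does not depend on the chart. -/
lemma chartIntegral_eq {x x' : S} {V : Set S} (hV : IsOpen V) (hx : V ⊆ (chartAt E2 x).source)
    (hx' : V ⊆ (chartAt E2 x').source) (g : S → ℝ) :
    chartIntegral x V g = chartIntegral x' V g := by
  have hman : IsManifold (𝓡 2) 1 S := IsManifold.of_le (n := ∞) (by simp)
  set e := chartAt E2 x with he
  set e' := chartAt E2 x' with he'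
  let τ : E2 → E2 := e' ∘ e.symm
  have hopen : IsOpen (e.target ∩ e.symm ⁻¹' V) :=
    e.symm.isOpen_inter_preimage hV
  have himage : τ '' (e.target ∩ e.symm ⁻¹' V) = e'.target ∩ e'.symm ⁻¹' V := by
    ext z
    constructor
    · rintro ⟨y, ⟨hy, hyV⟩, rfl⟩
      exact ⟨e'.map_source (hx' hyV), by simpa [τ, e'.left_inv (hx' hyV)] using hyV⟩
    · rintro ⟨hz, hzV⟩
      refine ⟨e (e'.symm z), ⟨e.map_source (hx hzV), ?_⟩, ?_⟩
      · simpa [e.left_inv (hx hzV)] using hzV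
      · simp [τ, e.left_inv (hx hzV), e'.right_inv hz]
  have hinj : InjOn τ (e.target ∩ e.symm ⁻¹' V) := by
    intro y hy z hz hyz
    have := congrArg e'.symm hyz
    simp only [τ, Function.comp_apply, e'.left_inv (hx' hy.2), e'.left_inv (hx' hz.2)] at this
    rw [← e.right_inv hy.1, this, e.right_inv hz.1]
  have hτ : ∀ y ∈ e.target ∩ e.symm ⁻¹' V, MDifferentiableAt (𝓡 2) (𝓡 2) τ y := fun y hy =>
    (mdifferentiableAt_atlas (chart_mem_atlas E2 x') (hx' hy.2)).comp y
      (mdifferentiableAt_atlas_symm (chart_mem_atlas E2 x) hy.1)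
  have hder : ∀ y ∈ e.target ∩ e.symm ⁻¹' V,
      chartDeriv x y = (chartDeriv x' (τ y)).comp (fderiv ℝ τ y) := by
    intro y hy
    have hev : e.symm =ᶠ[nhds y] e'.symm ∘ τ := by
      filter_upwards [hopen.mem_nhds hy] with z hz
      simp [τ, e'.left_inv (hx' hz.2)]
    rw [chartDeriv, ← he, hev.mfderiv_eq, ← mfderiv_eq_fderiv]
    exact mfderiv_comp y (mdifferentiableAt_atlas_symm (chart_mem_atlas E2 x')
      (e'.map_source (hx' hy.2))) (hτ y hy)
  rw [chartIntegral, chartIntegral, ← he, ← he', ← himage,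
    integral_image_eq_integral_abs_det_fderiv_smul volume hopen.measurableSet
      (fun y hy => ((hτ y hy).differentiableAt.hasFDerivAt).hasFDerivWithinAt) hinj]
  refine setIntegral_congr_fun hopen.measurableSet fun y hy => ?_
  have hdet : (chartDeriv x y).det = (chartDeriv x' (τ y)).det * (fderiv ℝ τ y).det := by
    rw [hder y hy, ContinuousLinearMap.det, ContinuousLinearMap.toLinearMap_comp,
      LinearMap.det_comp]
  simp only [hdet, abs_mul, smul_eq_mul]
  simp only [τ, Function.comp_apply, e'.left_inv (hx' hy.2)]
  ring

omit [IsManifold (𝓡 2) ∞ S] in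
lemma chartIntegral_inter {x : S} {V W : Set S} (hV : IsOpen V) {g : S → ℝ}
    (hg : ∀ p ∈ V, p ∉ W → g p = 0) : chartIntegral x (V ∩ W) g = chartIntegral x V g := by
  unfold chartIntegral
  refine (setIntegral_eq_of_subset_of_forall_sdiff_eq_zero
    ((chartAt E2 x).symm.isOpen_inter_preimage hV).measurableSet ?_ ?_).symm
  · intro y hy; exact ⟨hy.1, hy.2.1⟩
  · intro y hy
    rw [hg _ hy.1.2 fun h => hy.2 ⟨hy.1.1, hy.1.2, h⟩, zero_mul]

/-! ### Charts oriented by the Gauss map -/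

/-- The exterior derivative of `⟨B, dψ⟩` at `p`, as a density: its value in the preferred chart at
`p`, with the sign changed if that chart is not oriented by `N`. -/
def orientedWedge (ψ N B : S → E3) (p : S) : ℝ :=
  Real.sign (area (differential ψ p) (N p)) * wedge (differential B p) (differential ψ p)

/-- The area form of `ψ` in the preferred chart at `x`. -/
def chartArea (ψ N : S → E3) (x : S) (y : E2) : ℝ :=
  area (fderiv ℝ (ψ ∘ (chartAt E2 x).symm) y) (N ((chartAt E2 x).symm y))

/-- The sign of the orientation of the preferred chart at `x`, measured at `x` itself. -/
def chartSign (ψ N : S → E3) (x : S) : ℝ :=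
  Real.sign (chartArea ψ N x (chartAt E2 x x))

/-- The part of the source of the preferred chart at `x` on which the orientation of this chart
relative to `N` is the same as at `x`. -/
def orientedChart (ψ N : S → E3) (x : S) : Set S :=
  {p ∈ (chartAt E2 x).source | 0 < chartSign ψ N x * chartArea ψ N x (chartAt E2 x p)}

lemma sign_mul_abs {a d r : ℝ} (h : 0 < Real.sign r * (d * a)) :
    Real.sign a * |d| = Real.sign r * d := by
  rcases lt_trichotomy r 0 with hr | rfl | hr
  · rw [Real.sign_of_neg hr] at h ⊢
    rcases lt_trichotomy a 0 with ha | rfl | ha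
    · have hd : 0 < d := by by_contra! hd; nlinarith
      rw [Real.sign_of_neg ha, abs_of_pos hd]
    · simp at h
    · have hd : d < 0 := by by_contra! hd; nlinarith
      rw [Real.sign_of_pos ha, abs_of_neg hd]; ring
  · simp at h
  · rw [Real.sign_of_pos hr] at h ⊢
    rcases lt_trichotomy a 0 with ha | rfl | ha
    · have hd : d < 0 := by by_contra! hd; nlinarith
      rw [Real.sign_of_neg ha, abs_of_neg hd]; ring
    · simp at h
    · have hd : 0 < d := by by_contra! hd; nlinarith
      rw [Real.sign_of_pos ha, abs_of_pos hd]

/-- The derivative of the chart itself is a left inverse. -/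
lemma chartDeriv_det_ne_zero {x : S} {y : E2} (hy : y ∈ (chartAt E2 x).target) :
    (chartDeriv x y).det ≠ 0 := by
  have hman : IsManifold (𝓡 2) 1 S := IsManifold.of_le (n := ∞) (by simp)
  have hev : (chartAt E2 x) ∘ (chartAt E2 x).symm =ᶠ[nhds y] id := by
    filter_upwards [(chartAt E2 x).open_target.mem_nhds hy] with z hz
    simp [(chartAt E2 x).right_inv hz]
  have hcomp := mfderiv_comp (I := 𝓡 2) (I' := 𝓡 2) (I'' := 𝓡 2) y
    (mdifferentiableAt_atlas (chart_mem_atlas E2 x) ((chartAt E2 x).map_target hy))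
    (mdifferentiableAt_atlas_symm (chart_mem_atlas E2 x) hy)
  rw [hev.mfderiv_eq, mfderiv_id] at hcomp
  let A : E2 →L[ℝ] E2 := mfderiv (𝓡 2) (𝓡 2) (chartAt E2 x) ((chartAt E2 x).symm y)
  have h : ContinuousLinearMap.id ℝ E2 = A.comp (chartDeriv x y) := hcomp
  have hd : (1 : ℝ) = A.det * (chartDeriv x y).det := by
    have := congrArg ContinuousLinearMap.det h
    rw [ContinuousLinearMap.det, ContinuousLinearMap.det, ContinuousLinearMap.toLinearMap_comp,
      LinearMap.det_comp] at this
    simpa [ContinuousLinearMap.det] using this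
  intro h0
  rw [h0, mul_zero] at hd
  exact one_ne_zero hd

variable {ψ N : S → E3}

lemma chartArea_eq (hψ : ContMDiff (𝓡 2) (𝓡 3) ∞ ψ) {x : S} {y : E2}
    (hy : y ∈ (chartAt E2 x).target) :
    chartArea ψ N x y = (chartDeriv x y).det *
      area (differential ψ ((chartAt E2 x).symm y)) (N ((chartAt E2 x).symm y)) := by
  rw [chartArea, fderiv_comp_symm hψ hy, area_comp]

/-- On `orientedChart ψ N x`, passing to densities amounts to multiplication by a constant sign. -/
lemma orientedWedge_mul_abs_det (hψ : ContMDiff (𝓡 2) (𝓡 3) ∞ ψ) {B : S → E3}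
    (hB : ContMDiff (𝓡 2) (𝓡 3) ∞ B) {x : S} {y : E2} (hy : y ∈ (chartAt E2 x).target)
    (hyU : (chartAt E2 x).symm y ∈ orientedChart ψ N x) :
    orientedWedge ψ N B ((chartAt E2 x).symm y) * |(chartDeriv x y).det| = chartSign ψ N x *
      wedge (fderiv ℝ (B ∘ (chartAt E2 x).symm) y) (fderiv ℝ (ψ ∘ (chartAt E2 x).symm) y) := by
  have h := hyU.2
  rw [(chartAt E2 x).right_inv hy, chartArea_eq hψ hy] at h
  have hs := sign_mul_abs h
  rw [fderiv_comp_symm hψ hy, fderiv_comp_symm hB hy, wedge_comp, orientedWedge]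
  simp only [chartSign] at hs ⊢
  linear_combination (wedge (differential B ((chartAt E2 x).symm y))
    (differential ψ ((chartAt E2 x).symm y))) * hs

lemma continuousOn_chartArea (hψ : ContMDiff (𝓡 2) (𝓡 3) ∞ ψ) (hN : Continuous N) (x : S) :
    ContinuousOn (chartArea ψ N x) (chartAt E2 x).target := by
  have h1 : ContinuousOn (fderiv ℝ (ψ ∘ (chartAt E2 x).symm)) (chartAt E2 x).target :=
    (contDiffOn_comp_symm hψ x).continuousOn_fderiv_of_isOpen (chartAt E2 x).open_target (by simp)
  have h2 : ContinuousOn (fun y => N ((chartAt E2 x).symm y)) (chartAt E2 x).target :=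
    hN.comp_continuousOn (chartAt E2 x).continuousOn_symm
  have h3 : ∀ X : E2, ContinuousOn (fun y => fderiv ℝ (ψ ∘ (chartAt E2 x).symm) y X)
    (chartAt E2 x).target := fun X => h1.clm_apply continuousOn_const
  have h4 := h3 (coordVec 0)
  have h5 := h3 (coordVec 1)
  unfold chartArea area tripleProduct
  fun_prop

lemma isOpen_orientedChart (hψ : ContMDiff (𝓡 2) (𝓡 3) ∞ ψ) (hN : Continuous N) (x : S) :
    IsOpen (orientedChart ψ N x) := by
  have h : ContinuousOn (fun p => chartSign ψ N x * chartArea ψ N x (chartAt E2 x p))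
      (chartAt E2 x).source :=
    continuousOn_const.mul ((continuousOn_chartArea hψ hN x).comp (chartAt E2 x).continuousOn
      (chartAt E2 x).mapsTo)
  exact h.isOpen_inter_preimage (chartAt E2 x).open_source isOpen_Ioi

lemma mem_orientedChart (hψ : ContMDiff (𝓡 2) (𝓡 3) ∞ ψ)
    (hne : ∀ p, area (differential ψ p) (N p) ≠ 0) (x : S) : x ∈ orientedChart ψ N x := by
  refine ⟨mem_chart_source E2 x, ?_⟩
  have h : chartArea ψ N x (chartAt E2 x x) ≠ 0 := by
    rw [chartArea_eq hψ (mem_chart_target E2 x)]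
    exact mul_ne_zero (chartDeriv_det_ne_zero (mem_chart_target E2 x)) (hne _)
  rw [chartSign]
  exact Real.sign_mul_pos_of_ne_zero _ h

lemma continuousOn_wedge (hψ : ContMDiff (𝓡 2) (𝓡 3) ∞ ψ) {B : S → E3}
    (hB : ContMDiff (𝓡 2) (𝓡 3) ∞ B) (x : S) :
    ContinuousOn (fun y => wedge (fderiv ℝ (B ∘ (chartAt E2 x).symm) y)
      (fderiv ℝ (ψ ∘ (chartAt E2 x).symm) y)) (chartAt E2 x).target := by
  have h : ∀ {B : S → E3}, ContMDiff (𝓡 2) (𝓡 3) ∞ B → ∀ X : E2,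
      ContinuousOn (fun y => fderiv ℝ (B ∘ (chartAt E2 x).symm) y X)
      (chartAt E2 x).target := fun hB X =>
    ((contDiffOn_comp_symm hB x).continuousOn_fderiv_of_isOpen (chartAt E2 x).open_target
      (by simp)).clm_apply continuousOn_const
  exact ((h hB _).inner (𝕜 := ℝ) (h hψ _)).sub ((h hB _).inner (𝕜 := ℝ) (h hψ _))

omit [IsManifold (𝓡 2) ∞ S] in
lemma differential_eq_zero_of_notMem {B : S → E3} {p : S} (hp : p ∉ tsupport B) :
    differential B p = 0 := by
  have h : B =ᶠ[nhds p] fun _ => (0 : E3) := by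
    filter_upwards [(isClosed_tsupport B).isOpen_compl.mem_nhds hp] with q hq
      using image_eq_zero_of_notMem_tsupport hq
  rw [differential, h.mfderiv_eq, mfderiv_const]; rfl

omit [IsManifold (𝓡 2) ∞ S] in
lemma orientedWedge_eq_zero_of_notMem {B : S → E3} {p : S} (hp : p ∉ tsupport B) :
    orientedWedge ψ N B p = 0 := by
  rw [orientedWedge, differential_eq_zero_of_notMem hp]
  simp [wedge]

lemma continuousOn_density (hψ : ContMDiff (𝓡 2) (𝓡 3) ∞ ψ) {B : S → E3}
    (hB : ContMDiff (𝓡 2) (𝓡 3) ∞ B) {ρ : S → ℝ} (hρ : Continuous ρ) (x : S) :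
    ContinuousOn (fun y => ρ ((chartAt E2 x).symm y) *
      orientedWedge ψ N B ((chartAt E2 x).symm y) * |(chartDeriv x y).det|)
      ((chartAt E2 x).target ∩ (chartAt E2 x).symm ⁻¹' orientedChart ψ N x) := by
  set e := chartAt E2 x with he
  have hc : ContinuousOn (fun y => ρ (e.symm y) * (chartSign ψ N x *
      wedge (fderiv ℝ (B ∘ e.symm) y) (fderiv ℝ (ψ ∘ e.symm) y)))
      (e.target ∩ e.symm ⁻¹' orientedChart ψ N x) :=
    ((hρ.comp_continuousOn e.continuousOn_symm).mul
      (continuousOn_const.mul (continuousOn_wedge hψ hB x))).mono inter_subset_left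
  refine hc.congr fun y hy => ?_
  simp only
  rw [mul_assoc, orientedWedge_mul_abs_det hψ hB hy.1 hy.2]

/-- The density `ρ d⟨B, dψ⟩`, supported in a closed subset of an oriented chart, is integrable: in the
chart it is continuous and vanishes outside a compact set. -/
lemma integrableOn_density [CompactSpace S] (hψ : ContMDiff (𝓡 2) (𝓡 3) ∞ ψ)
    (hN : Continuous N) {B : S → E3}
    (hB : ContMDiff (𝓡 2) (𝓡 3) ∞ B) {ρ : S → ℝ} (hρ : Continuous ρ) {x : S} {K : Set S}
    (hK : IsClosed K) (hKU : K ⊆ orientedChart ψ N x)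
    (h0 : ∀ p, p ∉ K → ρ p * orientedWedge ψ N B p = 0) :
    IntegrableOn (fun y => ρ ((chartAt E2 x).symm y) *
      orientedWedge ψ N B ((chartAt E2 x).symm y) * |(chartDeriv x y).det|)
      ((chartAt E2 x).target ∩ (chartAt E2 x).symm ⁻¹' orientedChart ψ N x) := by
  set e := chartAt E2 x with he
  refine integrableOn_of_eq_zero_off_compact (K := e '' K)
    (e.symm.isOpen_inter_preimage (isOpen_orientedChart hψ hN x))
    (hK.isCompact.image_of_continuousOn (e.continuousOn.mono fun p hp => (hKU hp).1)) ?_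
    (continuousOn_density hψ hB hρ x) ?_
  · rintro _ ⟨p, hp, rfl⟩
    refine ⟨e.map_source (hKU hp).1, ?_⟩
    rw [mem_preimage, e.left_inv (hKU hp).1]
    exact hKU hp
  · intro y hy hyK
    rw [h0, zero_mul]
    intro h
    exact hyK ⟨_, h, e.right_inv hy.1⟩

/-- Stokes' theorem for a one-form `⟨B, dψ⟩` supported in an oriented chart. -/
lemma chartIntegral_orientedWedge_eq_zero [CompactSpace S] (hψ : ContMDiff (𝓡 2) (𝓡 3) ∞ ψ)
    (hN : Continuous N) {B : S → E3}
    (hB : ContMDiff (𝓡 2) (𝓡 3) ∞ B) {x : S} (hBU : tsupport B ⊆ orientedChart ψ N x) :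
    chartIntegral x (orientedChart ψ N x) (orientedWedge ψ N B) = 0 := by
  set e := chartAt E2 x with he
  have hopen : IsOpen (e.target ∩ e.symm ⁻¹' orientedChart ψ N x) :=
    e.symm.isOpen_inter_preimage (isOpen_orientedChart hψ hN x)
  rw [chartIntegral, ← he]
  have h1 : ∫ y in e.target ∩ e.symm ⁻¹' orientedChart ψ N x,
      orientedWedge ψ N B (e.symm y) * |(chartDeriv x y).det| =
      ∫ y in e.target ∩ e.symm ⁻¹' orientedChart ψ N x, chartSign ψ N x *
        wedge (fderiv ℝ (B ∘ e.symm) y) (fderiv ℝ (ψ ∘ e.symm) y) :=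
    setIntegral_congr_fun hopen.measurableSet fun y hy =>
      orientedWedge_mul_abs_det hψ hB hy.1 hy.2
  rw [h1, integral_const_mul, setIntegral_wedge_eq_zero (K := e '' tsupport B) hopen, mul_zero]
  · exact (isClosed_tsupport B).isCompact.image_of_continuousOn
      (e.continuousOn.mono fun p hp => (hBU hp).1)
  · rintro _ ⟨p, hp, rfl⟩
    refine ⟨e.map_source (hBU hp).1, ?_⟩
    rw [mem_preimage, e.left_inv (hBU hp).1]
    exact hBU hp
  · exact ((contDiffOn_comp_symm hB x).mono inter_subset_left).of_le (by simp)
  · exact ((contDiffOn_comp_symm hψ x).mono inter_subset_left).of_le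
      ENat.LEInfty.out
  · intro y hy hyK
    exact image_eq_zero_of_notMem_tsupport (f := B) fun h => hyK ⟨_, h, e.right_inv hy.1⟩

/-! ### Stokes' theorem: exact forms integrate to zero on a closed surface -/

omit [IsManifold (𝓡 2) ∞ S] in
lemma differential_sum {ι : Type*} (t : Finset ι) {B : ι → S → E3}
    (hB : ∀ i, ContMDiff (𝓡 2) (𝓡 3) ∞ (B i)) (q : S) :
    MDifferentiableAt (𝓡 2) (𝓡 3) (∑ i ∈ t, B i) q ∧
      differential (∑ i ∈ t, B i) q = ∑ i ∈ t, differential (B i) q := by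
  classical
  induction t using Finset.induction_on with
  | empty =>
    rw [Finset.sum_empty, Finset.sum_empty]
    exact ⟨mdifferentiableAt_const, mfderiv_const⟩
  | insert i t hi ih =>
    have h := (((hB i q).mdifferentiableAt (by simp)).hasMFDerivAt).add ih.1.hasMFDerivAt
    rw [Finset.sum_insert hi, Finset.sum_insert hi, ← ih.2]
    exact ⟨h.mdifferentiableAt, h.mfderiv⟩

/-- On a closed surface, if the exact form `d⟨A, dψ⟩` is everywhere a nonnegative multiple of the
area form, then it vanishes identically, because its integral is zero. -/
lemma eq_zero_of_orientedWedge_nonneg [T2Space S] [CompactSpace S]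
    (hψ : ContMDiff (𝓡 2) (𝓡 3) ∞ ψ)
    (hN : Continuous N) (hne : ∀ p, area (differential ψ p) (N p) ≠ 0)
    {A : S → E3} (hA : ContMDiff (𝓡 2) (𝓡 3) ∞ A)
    (h0 : ∀ p, 0 ≤ orientedWedge ψ N A p) (p : S) : orientedWedge ψ N A p = 0 := by
  classical
  have hUo := isOpen_orientedChart (S := S) hψ hN
  obtain ⟨t, ht⟩ := isCompact_univ.elim_finite_subcover (orientedChart ψ N) hUo
    fun x _ => mem_iUnion.2 ⟨x, mem_orientedChart hψ hne x⟩
  obtain ⟨ρ, hρ⟩ := SmoothPartitionOfUnity.exists_isSubordinate (𝓡 2) isClosed_univ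
    (fun i : t => orientedChart ψ N i.1) (fun i => hUo i.1)
    (by intro x hx; simpa using ht hx)
  have hsum : ∀ q, ∑ i, ρ i q = 1 := fun q => by
    rw [← finsum_eq_sum_of_fintype]; exact ρ.sum_eq_one (mem_univ q)
  have hρc : ∀ i, Continuous (ρ i) := fun i => (ρ i).contMDiff.continuous
  set B : t → S → E3 := fun i q => ρ i q • A q with hBdef
  have hB : ∀ i, ContMDiff (𝓡 2) (𝓡 3) ∞ (B i) := fun i => (ρ i).contMDiff.smul hA
  have hBsupp : ∀ i, tsupport (B i) ⊆ orientedChart ψ N i.1 := fun i =>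
    (closure_mono (Function.support_smul_subset_left (ρ i) A)).trans (hρ i)
  have hρsupp : ∀ i q, q ∉ orientedChart ψ N i.1 → ρ i q = 0 := fun i q hq =>
    image_eq_zero_of_notMem_tsupport fun h => hq (hρ i h)
  have hBsum : ∀ q, ∑ i, orientedWedge ψ N (B i) q = orientedWedge ψ N A q := by
    intro q
    have hd : differential A q = ∑ i, differential (B i) q := by
      have h1 : A = ∑ i, B i := by
        ext1 r
        rw [Finset.sum_apply, hBdef, ← Finset.sum_smul, hsum, one_smul]
      rw [← (differential_sum Finset.univ hB q).2, ← h1]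
    simp only [orientedWedge, hd, ← Finset.mul_sum, wedge, Finset.sum_sub_distrib,
      sum_apply, sum_inner]
  -- The mixed terms vanish outside the overlap of the charts `i` and `j`, hence may be computed in
  -- either of the two charts.
  have hswap : ∀ i j : t,
      chartIntegral i.1 (orientedChart ψ N i.1) (fun q => ρ j q * orientedWedge ψ N (B i) q) =
      chartIntegral j.1 (orientedChart ψ N j.1) (fun q => ρ j q * orientedWedge ψ N (B i) q) := by
    intro i j
    rw [← chartIntegral_inter (W := orientedChart ψ N j.1) (hUo i.1),
      ← chartIntegral_inter (x := j.1) (W := orientedChart ψ N i.1) (hUo j.1), inter_comm,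
      chartIntegral_eq ((hUo j.1).inter (hUo i.1)) (fun _ h => h.2.1) (fun _ h => h.1.1)]
    · intro q _ hq
      rw [orientedWedge_eq_zero_of_notMem fun h => hq (hBsupp i h), mul_zero]
    · intro q _ hq
      rw [hρsupp j q hq, zero_mul]
  -- Summed over `j`, they give the integral of `d⟨B i, dψ⟩` over a single chart.
  have hrow : ∀ i : t, ∑ j : t, chartIntegral i.1 (orientedChart ψ N i.1)
      (fun q => ρ j q * orientedWedge ψ N (B i) q) = 0 := by
    intro i
    rw [← chartIntegral_orientedWedge_eq_zero hψ hN (hB i) (hBsupp i)]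
    simp only [chartIntegral]
    rw [← integral_finsetSum]
    · simp only [← Finset.sum_mul, hsum, one_mul]
    · intro j _
      refine integrableOn_density hψ hN (hB i) (hρc j) (isClosed_tsupport (B i)) (hBsupp i) ?_
      intro q hq
      rw [orientedWedge_eq_zero_of_notMem hq, mul_zero]
  have hρ0 : ∀ j (q : S), q ∉ tsupport (ρ j) → ρ j q = 0 := fun j q hq =>
    image_eq_zero_of_notMem_tsupport hq
  -- Summed over `i`, they give the integral of `ρ j d⟨A, dψ⟩`.
  have hcol : ∀ j : t, ∑ i : t, chartIntegral j.1 (orientedChart ψ N j.1)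
      (fun q => ρ j q * orientedWedge ψ N (B i) q) = chartIntegral j.1 (orientedChart ψ N j.1)
      (fun q => ρ j q * orientedWedge ψ N A q) := by
    intro j
    simp only [chartIntegral]
    rw [← integral_finsetSum]
    · simp only [← Finset.sum_mul, ← Finset.mul_sum, hBsum]
    · intro i _
      refine integrableOn_density hψ hN (hB i) (hρc j) (isClosed_tsupport (ρ j)) (hρ j) ?_
      intro q hq
      rw [hρ0 j q hq, zero_mul]
  have htotal : ∑ j : t, chartIntegral j.1 (orientedChart ψ N j.1)
      (fun q => ρ j q * orientedWedge ψ N A q) = 0 := by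
    simp_rw [← hcol]
    rw [Finset.sum_comm]
    simp_rw [← hswap, hrow, Finset.sum_const_zero]
  have hnn : ∀ j : t, ∀ q, 0 ≤ ρ j q * orientedWedge ψ N A q := fun j q =>
    mul_nonneg (ρ.nonneg j q) (h0 q)
  obtain ⟨j, hj⟩ : ∃ j, ρ j p ≠ 0 := by
    by_contra! h
    simpa [h] using hsum p
  have hpU : p ∈ orientedChart ψ N j.1 := by
    by_contra h
    exact hj (hρsupp j p h)
  have hj0 : chartIntegral j.1 (orientedChart ψ N j.1)
      (fun q => ρ j q * orientedWedge ψ N A q) = 0 := by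
    refine (Finset.sum_eq_zero_iff_of_nonneg fun j _ => ?_).1 htotal j (Finset.mem_univ j)
    exact integral_nonneg fun y => mul_nonneg (hnn _ _) (abs_nonneg _)
  -- A continuous nonnegative function on an open set whose integral vanishes is zero.
  set e := chartAt E2 j.1 with he
  set Ω := e.target ∩ e.symm ⁻¹' orientedChart ψ N j.1 with hΩ
  have hΩo : IsOpen Ω := e.symm.isOpen_inter_preimage (hUo j.1)
  have hint := integrableOn_density hψ hN hA (hρc j) (isClosed_tsupport (ρ j)) (hρ j)
    fun q hq => by rw [hρ0 j q hq, zero_mul]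
  have hae := (setIntegral_eq_zero_iff_of_nonneg_ae
    (Filter.Eventually.of_forall fun y => mul_nonneg (hnn _ _) (abs_nonneg _)) hint).1 hj0
  have heq := Measure.eqOn_open_of_ae_eq hae hΩo (continuousOn_density hψ hA (hρc j) j.1)
    continuousOn_const
  have hpΩ : e p ∈ Ω := by
    refine ⟨e.map_source hpU.1, ?_⟩
    rw [mem_preimage, e.left_inv hpU.1]; exact hpU
  have hp := heq hpΩ
  simp only [Pi.zero_apply, mul_eq_zero, abs_eq_zero, chartDeriv_det_ne_zero hpΩ.1,
    or_false] at hp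
  rw [← he, e.left_inv hpU.1] at hp
  exact hp.resolve_left hj

/-! ### Maxima of the height and derivatives of the Gauss map -/

/-- Where the height in the direction `v` is maximal, the tangent plane is orthogonal to `v`. -/
lemma inner_differential_eq_zero_of_isMax (hψ : ContMDiff (𝓡 2) (𝓡 3) ∞ ψ) {v : E3} {p : S}
    (hp : ∀ q, inner ℝ v (ψ q) ≤ inner ℝ v (ψ p)) (X : E2) :
    inner ℝ v (differential ψ p X) = 0 := by
  set e := chartAt E2 p with he
  have hmax : IsLocalMax (fun y => inner ℝ v ((ψ ∘ e.symm) y)) (e p) := by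
    refine Filter.Eventually.of_forall fun y => ?_
    simpa [e.left_inv (mem_chart_source E2 p)] using hp (e.symm y)
  have hd : DifferentiableAt ℝ (ψ ∘ e.symm) (e p) :=
    ((contDiffOn_comp_symm hψ p).contDiffAt
      (e.open_target.mem_nhds (mem_chart_target E2 p))).differentiableAt (by simp)
  have h0 : ∀ Y, inner ℝ v (differential ψ p (chartDeriv p (e p) Y)) = 0 := by
    intro Y
    have h1 := congrArg (fun L => L Y) hmax.fderiv_eq_zero
    simp only [fderiv_inner_apply ℝ (differentiableAt_const v) hd] at h1
    rw [fderiv_comp_symm hψ (mem_chart_target E2 p), ← he, e.left_inv (mem_chart_source E2 p)] at h1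
    simpa using h1
  have hdet := chartDeriv_det_ne_zero (mem_chart_target E2 p)
  obtain ⟨Y, rfl⟩ : ∃ Y, chartDeriv p (e p) Y = X :=
    (LinearMap.equivOfDetNeZero (chartDeriv p (e p) : E2 →ₗ[ℝ] E2) hdet).surjective X
  exact h0 Y

omit [IsManifold (𝓡 2) ∞ S] in
/-- A unit normal is orthogonal to its derivatives, which are therefore tangent to the surface. -/
lemma IsGaussMap.inner_differential_eq_zero (h : IsGaussMap ψ N) (p : S) (X : E2) :
    inner ℝ (N p) (differential N p X) = 0 := by
  have h1 := (hasStrictFDerivAt_norm_sq (N p)).hasFDerivAt.hasMFDerivAt.comp p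
    ((h.smooth p).mdifferentiableAt (by simp)).hasMFDerivAt
  have h2 : (fun x : E3 => ‖x‖ ^ 2) ∘ N = fun _ => (1 : ℝ) := by
    ext q; simp [h.unit q]
  rw [h2] at h1
  have h3 := congrArg (fun L => L X) (h1.mfderiv.symm.trans mfderiv_const)
  change (2 • innerSL ℝ (N p)) (differential N p X) = 0 at h3
  simpa using h3

omit [IsManifold (𝓡 2) ∞ S] in
lemma differential_crossRight {v : E3} {lam : ℝ} (hψ : ContMDiff (𝓡 2) (𝓡 3) ∞ ψ)
    (hN : ContMDiff (𝓡 2) (𝓡 3) ∞ N) (p : S) :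
    differential (fun q => crossRight v (N q + lam • ψ q)) p =
      (crossRight v).comp (differential N p + lam • differential ψ p) := by
  have h1 := ((hN p).mdifferentiableAt (by simp)).hasMFDerivAt
  have h2 := (((hψ p).mdifferentiableAt (by simp)).hasMFDerivAt).const_smul lam
  exact (((crossRight v).hasMFDerivAt).comp p (h1.add h2)).mfderiv

end Surface

end LambdaSoliton

end

theorem mainTheorem1 (v : LambdaSoliton.E3) (hv : ‖v‖ = 1) (lam : ℝ)
    {S : Type*} [TopologicalSpace S] [ChartedSpace LambdaSoliton.E2 S]
    [IsManifold (𝓡 2) ∞ S] [T2Space S] [CompactSpace S] [Nonempty S]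
    (ψ N : S → LambdaSoliton.E3) :
    ¬ LambdaSoliton.IsTranslatingSoliton v lam ψ N := by
  open LambdaSoliton in
  intro h
  have hψ : ContMDiff (𝓡 2) (𝓡 3) ∞ ψ := h.immersion.contMDiff
  have hN := h.gauss.smooth
  have hinj := differential_injective h.immersion
  have hne : ∀ p, area (differential ψ p) (N p) ≠ 0 := fun p =>
    area_ne_zero (h.gauss.unit p) (h.gauss.orthogonal p) (hinj p)
  have hA : ContMDiff (𝓡 2) (𝓡 3) ∞ (fun q => crossRight v (N q + lam • ψ q)) :=
    (crossRight v).contMDiff.comp (hN.add (ContMDiff.smul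
      (contMDiff_const : ContMDiff (𝓡 2) 𝓘(ℝ, ℝ) ∞ fun _ : S => lam) hψ))
  -- The soliton equation turns the factor `2 H - 2 lam` of `wedge_cross` into `⟨N, v⟩`.
  have hwedge : ∀ p, orientedWedge ψ N (fun q => crossRight v (N q + lam • ψ q)) p =
      inner ℝ (N p) v ^ 2 * |area (differential ψ p) (N p)| := by
    intro p
    have hw := wedge_cross (h.gauss.unit p) (h.gauss.orthogonal p)
      (h.gauss.inner_differential_eq_zero p) (hinj p) v lam (firstFundamentalForm ψ p)
      (secondFundamentalForm ψ N p) rfl rfl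
    have hH := h.curvature_eq p
    rw [meanCurvature] at hH
    have hs : Real.sign (area (differential ψ p) (N p)) * area (differential ψ p) (N p) =
        |area (differential ψ p) (N p)| := by
      rcases (hne p).lt_or_gt with ha | ha
      · rw [Real.sign_of_neg ha, abs_of_neg ha]; ring
      · rw [Real.sign_of_pos ha, abs_of_pos ha, one_mul]
    rw [orientedWedge, differential_crossRight hψ hN, hw, ← hs]
    linear_combination (2 * Real.sign (area (differential ψ p) (N p)) * inner ℝ (N p) v *
      area (differential ψ p) (N p)) * hH
  have hzero : ∀ p, inner ℝ (N p) v = 0 := by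
    intro p
    have := eq_zero_of_orientedWedge_nonneg hψ hN.continuous hne hA
      (fun q => by rw [hwedge]; positivity) p
    rw [hwedge] at this
    simpa [hne p] using this
  -- At a highest point `v` is orthogonal both to the normal and to the tangent plane.
  obtain ⟨p, -, hp⟩ := isCompact_univ.exists_isMaxOn Set.univ_nonempty
    ((continuous_const.inner (𝕜 := ℝ) hψ.continuous).continuousOn (f := fun q => inner ℝ v (ψ q)))
  have hperp := inner_differential_eq_zero_of_isMax hψ (v := v) fun q => hp (Set.mem_univ q)
  obtain ⟨s, t, hst⟩ := exists_eq_smul_add_smul (h.gauss.unit p) (h.gauss.orthogonal p)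
    (hinj p) (hzero p)
  have hvv : inner ℝ v v = 0 := by
    conv_lhs => arg 3; rw [hst]
    rw [inner_add_right, real_inner_smul_right, real_inner_smul_right, hperp, hperp]; ring
  rw [real_inner_self_eq_norm_sq, hv] at hvv
  norm_num at hvv
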